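/- Let $\mathbb{R}_+=[0,\infty)$ and let $\omega:\mathbb{R}_+\to\mathbb{R}$ be continuous with $\omega(0)=0$; write $\mathrm{e}(t)=t$. For $\varepsilon>0$, let $\varphi=\varphi_\varepsilon:[0,T)\to\mathbb{R}_+$, $T=T_\varepsilon\in(0,\infty]$, be a maximal (non-continuable) solution of the Cox–Ingersoll–Ross initial-value problem $$\varphi'(t)=\varepsilon^{-1}\big(\omega(\varphi(t))+t-\varphi(t)\big)+1,\qquad \varphi(0)=0.$$ For a path $\psi$ put $S(\psi)(x)=\sup\{\psi(u):u\in[0,x)\}$ for $x>0$, $S(\psi)(0)=\psi(0)$, $S(\psi)(\infty)=\sup_{u\ge0}\psi(u)$, and $E(\psi)(x)=\inf\{u>0:\psi(u)>x\}\in[0,\infty]$, with $\inf\varnothing=\infty$ and $u$ ranging over the domain of $\psi$. (1) $\varphi$ is a bijection from $[0,T)$ onto $\mathbb{R}_+$, the exit time $\hat\varphi:=E(\varphi)$ is its inverse, and for every $x\ge0$ $$S(\mathrm{e}-\omega)(x)-\varepsilon\;\le\;\hat\varphi(x)\;\le\;S(\mathrm{e}-\omega)(x)+2\sqrt{x\varepsilon}.$$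 (2) For any family $(\varphi_\varepsilon)_{\varepsilon>0}$ of such solutions, $\hat\varphi_\varepsilon=E(\varphi_\varepsilon)$ and $S(\mathrm{e}-\omega)$ are real-valued continuous functions on $\mathbb{R}_+$ starting from $0$, and $\hat\varphi_\varepsilon\to S(\mathrm{e}-\omega)$ locally uniformly on $\mathbb{R}_+$ as $\varepsilon\to0$. (3) Let $\sigma=S(\mathrm{e}-\omega)(\infty)\in[0,\infty]$. On $[0,\sigma)$ the path $\varphi_0:=E(\mathrm{e}-\omega)$ is finite and càdlàg, and as $\varepsilon\to0$, $\varphi_\varepsilon\to\varphi_0$ on $[0,\sigma)$ in Skorokhod's $M_1$ topology, in the variant $M_1'$ of Puhalskii and Whitt in which completed graphs start from the origin (that is, $x(0-):=0$ for every path $x$). Explicitly: for every continuity point $t\in(0,\sigma)$ of $\varphi_0$, one has $T_\varepsilon>t$ for all sufficiently small $\varepsilon$, and $d_t(\varphi_\varepsilon,\varphi_0)\to0$. Here $d_t(x,y)$ is the infimum of $\sup_{v\in[0,1]}\max(|u_1(v)-u_2(v)|,|r_1(v)-r_2(v)|)$ over all parametric representations $(u_1,r_1)$ of $x$ and $(u_2,r_2)$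 of $y$ on $[0,t]$. A parametric representation of $x$ on $[0,t]$ is a continuous map of $[0,1]$ onto the completed graph $\{(z,s):0\le s\le t,\ z\text{ between }x(s-)\text{ and }x(s)\}$ that is nondecreasing for the order in which $s$ increases and, at equal $s$, $|z-x(s-)|$ increases. If $\sigma=\infty$, this is convergence on all of $[0,\infty)$. -/

import Mathlib

open Set Filter Topology

noncomputable section

namespace CIR

/-- The driving function `f(t, x) = ε⁻¹ (ω(x) + t - x) + 1`. -/
def drift (ω : ℝ → ℝ) (ε t x : ℝ) : ℝ := ε⁻¹ * (ω x + t - x) + 1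

/-- The time interval `[0, T)`, where `T` may be infinite. -/
def timeDomain (T : EReal) : Set ℝ := {t : ℝ | 0 ≤ t ∧ (t : EReal) < T}

/-- `φ : [0, T) → [0, ∞)` with `T ∈ (0, ∞]` solves `φ' = f(t, φ)`, `φ(0) = 0`.  The derivative at
`0` is the right derivative, and at `t ∈ (0, T)` it is the usual two-sided one.  Values of `φ`
outside `[0, T)` play no role. -/
structure IsSolution (ω : ℝ → ℝ) (ε : ℝ) (T : EReal) (φ : ℝ → ℝ) : Prop where
  pos : 0 < T
  init : φ 0 = 0
  nonneg : ∀ t ∈ timeDomain T, 0 ≤ φ t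
  hasDeriv : ∀ t ∈ timeDomain T, HasDerivWithinAt φ (drift ω ε t (φ t)) (Ici 0) t

/-- A solution on `[0, T)` that has no continuation to a longer interval. -/
structure IsMaximalSolution (ω : ℝ → ℝ) (ε : ℝ) (T : EReal) (φ : ℝ → ℝ) : Prop where
  isSolution : IsSolution ω ε T φ
  maximal : ∀ (T' : EReal) (ψ : ℝ → ℝ), IsSolution ω ε T' ψ → T ≤ T' →
    EqOn ψ φ (timeDomain T) → T' ≤ T

/-- The supremum functional `S(φ)(t) = sup {φ(u) : u ∈ [0, t)}`.  At `t = 0` the supremum is taken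
over the empty set and is `0`, the initial value of the paths it is used for. -/
def S (φ : ℝ → ℝ) (t : ℝ) : ℝ := sSup (φ '' Ico 0 t)

/-- `S(φ)(∞) = sup {φ(u) : u ∈ [0, ∞)}`, possibly infinite. -/
def SInfty (φ : ℝ → ℝ) : EReal := ⨆ u ∈ Ici (0 : ℝ), (φ u : EReal)

/-- The exit-time functional `E(φ)(x) = inf {u > 0 : φ(u) > x}` of a path `φ` on `[0, T)`, with
`inf ∅ = ∞`. -/
def E (T : EReal) (φ : ℝ → ℝ) (x : ℝ) : EReal :=
  sInf ((fun u : ℝ => (u : EReal)) '' {u : ℝ | 0 < u ∧ (u : EReal) < T ∧ x < φ u})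

/-- `x` is càdlàg on `[0, T)`. -/
def IsCadlag (T : EReal) (x : ℝ → ℝ) : Prop :=
  (∀ t ∈ timeDomain T, ContinuousWithinAt x (Ici t) t) ∧
    ∀ t ∈ timeDomain T, 0 < t → ∃ l : ℝ, Tendsto x (𝓝[<] t) (𝓝 l)

/-- The left limit `x(s-)`, with the convention `x(0-) = 0`. -/
def leftValue (x : ℝ → ℝ) (s : ℝ) : ℝ := if s ≤ 0 then 0 else Function.leftLim x s

/-- The completed graph over `[0, t]`: the pairs `(z, s)` with `s ∈ [0, t]` and `z` on the segment
between `x(s-)` and `x(s)`. -/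
def completedGraph (t : ℝ) (x : ℝ → ℝ) : Set (ℝ × ℝ) :=
  {p | p.2 ∈ Icc 0 t ∧ p.1 ∈ uIcc (leftValue x p.2) (x p.2)}

/-- The order along the completed graph. -/
def graphLE (x : ℝ → ℝ) (p q : ℝ × ℝ) : Prop :=
  p.2 < q.2 ∨ (p.2 = q.2 ∧ |leftValue x p.2 - p.1| ≤ |leftValue x p.2 - q.1|)

/-- A parametric representation: a continuous map of `[0, 1]` onto the completed graph that is
nondecreasing for the order along the graph. -/
structure IsParamRep (t : ℝ) (x : ℝ → ℝ) (g : ℝ → ℝ × ℝ) : Prop where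
  cont : ContinuousOn g (Icc 0 1)
  onto : g '' Icc 0 1 = completedGraph t x
  mono : ∀ v ∈ Icc (0 : ℝ) 1, ∀ w ∈ Icc (0 : ℝ) 1, v ≤ w → graphLE x (g v) (g w)

/-- The distance `d_t(x, y)` of the restrictions of two paths to `[0, t]`: the infimum, over all
pairs of parametric representations, of their uniform distance (for the maximum norm of
space and time). -/
def m1Dist (t : ℝ) (x y : ℝ → ℝ) : ENNReal :=
  ⨅ (g : ℝ → ℝ × ℝ) (h : ℝ → ℝ × ℝ) (_ : IsParamRep t x g) (_ : IsParamRep t y h),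
    ⨆ v ∈ Icc (0 : ℝ) 1, edist (g v) (h v)

/-- Convergence of the paths `x i` on `[0, T i)` to the path `y` on `[0, σ)`: for every continuity
point `t ∈ (0, σ)` of `y`, eventually `x i` is defined on `[0, t]`, and the distance of the
restrictions to `[0, t]` tends to `0`.  For `σ = ∞` and `T i = ∞` this is convergence in
`D([0, ∞))`. -/
def TendstoM1 {ι : Type*} (l : Filter ι) (T : ι → EReal) (x : ι → ℝ → ℝ)
    (σ : EReal) (y : ℝ → ℝ) : Prop :=
  ∀ t : ℝ, 0 < t → (t : EReal) < σ → ContinuousAt y t →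
    (∀ᶠ i in l, (t : EReal) < T i) ∧ Tendsto (fun i => m1Dist t (x i) y) l (𝓝 0)

end CIR

end

/-! The drift increases strictly with time, so a solution stays below each of its own forward time
shifts: the shift starts from a nonnegative value and has the larger slope wherever the two meet.
Hence `φ` is strictly increasing, and everything can be read off from its inverse.

Write η(u) = u - ω(u). Nonnegativity of φ' says η(φ(s)) ≤ s + ε; taking all s ≤ t gives the lower
bound (`S_sub_le`). Conversely, put a = S(η)(φ(t)). Up to time t one has η(φ(s)) ≤ a, so φ'(s) ≥ (s
- a)/ε on [a, t], and integration yields (t - a)² ≤ 2εφ(t), whence the upper bound (`le_S_add`).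
This bound also keeps a global solution from being bounded, while a bounded solution on a finite
interval could be continued by Peano's theorem (`exists_extension`); so a maximal solution is onto.

The two bounds give locally uniform convergence of the inverses. For M1, exchange the coordinates:
the completed graph of the limit is the transposed graph of S(η) (`completedGraph_toReal_E_top`),
and that of `φ` is the transposed graph of its inverse. Both are parametrized by the space
coordinate, so closeness of the inverses is M1 closeness as soon as the end points at time t
converge (`tendsto_apply`); this is where continuity of the limit at t enters. -/

noncomputable section

namespace CIR

/-! ### Peano's existence theorem via the Euler scheme. -/

/-- The explicit Euler scheme with step `h` for `x' = F(t, x)`. -/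
def eulerScheme (F : ℝ → ℝ → ℝ) (x₀ h : ℝ) : ℕ → ℝ
  | 0 => x₀
  | k + 1 => eulerScheme F x₀ h k + h * F (k * h) (eulerScheme F x₀ h k)

/-- A discrete mean value inequality: the one-step errors add up. With `c = 0` it gives the
Lipschitz bound on the scheme, with `c = F t (x t)` the derivative of the limit. -/
lemma abs_eulerScheme_sub_le {F : ℝ → ℝ → ℝ} {x₀ h c r : ℝ} (hh : 0 ≤ h) {i j : ℕ} (hij : i ≤ j)
    (hF : ∀ k, i ≤ k → k < j → |F (k * h) (eulerScheme F x₀ h k) - c| ≤ r) :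
    |eulerScheme F x₀ h j - eulerScheme F x₀ h i - (j - i) * h * c| ≤ (j - i) * h * r := by
  induction j, hij using Nat.le_induction with
  | base => simp
  | succ k hik ih =>
    have h1 := ih fun m hm hmk => hF m hm (hmk.trans k.lt_succ_self)
    have h2 := mul_le_mul_of_nonneg_left (hF k hik k.lt_succ_self) hh
    rw [← abs_of_nonneg hh, ← abs_mul, abs_of_nonneg hh] at h2
    have h3 := (abs_add_le _ _).trans (add_le_add h1 h2)
    rw [show eulerScheme F x₀ h (k + 1) =
      eulerScheme F x₀ h k + h * F (k * h) (eulerScheme F x₀ h k) from rfl]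
    push_cast
    calc _ = |eulerScheme F x₀ h k - eulerScheme F x₀ h i - (k - i) * h * c +
          h * (F (k * h) (eulerScheme F x₀ h k) - c)| := by ring_nf
      _ ≤ _ := h3
      _ = _ := by ring

/-- Peano's existence theorem for a scalar equation with bounded continuous right-hand side. -/
theorem exists_hasDerivWithinAt_of_continuous_bounded {F : ℝ → ℝ → ℝ}
    (hF : Continuous (Function.uncurry F)) {M : ℝ} (hM : ∀ t x, |F t x| ≤ M) (x₀ : ℝ) :
    ∃ x : ℝ → ℝ, x 0 = x₀ ∧ ∀ t, 0 ≤ t → HasDerivWithinAt x (F t (x t)) (Ici 0) t := by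
  have hM0 : 0 ≤ M := (abs_nonneg _).trans (hM 0 0)
  let h : ℕ → ℝ := fun n => ((n : ℝ) + 1)⁻¹
  have hpos : ∀ n, 0 < h n := fun n => by positivity
  have hlim : Tendsto h atTop (𝓝 0) := by
    simpa [h, one_div] using tendsto_one_div_add_atTop_nhds_zero_nat (𝕜 := ℝ)
  let N : ℝ → ℕ → ℕ := fun t n => ⌊t / h n⌋₊
  have hN1 : ∀ t n, 0 ≤ t → N t n * h n ≤ t := fun t n ht => by
    have := Nat.floor_le (div_nonneg ht (hpos n).le)
    rwa [le_div_iff₀ (hpos n)] at this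
  have hN2 : ∀ t n, t < N t n * h n + h n := fun t n => by
    have := Nat.lt_floor_add_one (t / h n)
    rw [div_lt_iff₀ (hpos n)] at this
    linarith
  let y : ℝ → ℕ → ℝ := fun t n => eulerScheme F x₀ (h n) (N t n)
  have hLip : ∀ n i j, i ≤ j →
      |eulerScheme F x₀ (h n) j - eulerScheme F x₀ (h n) i| ≤ (j - i) * h n * M := fun n i j hij => by
    simpa using abs_eulerScheme_sub_le (c := 0) (hpos n).le hij fun k _ _ => by simpa using hM _ _
  -- A free ultrafilter replaces the Arzelà–Ascoli theorem: the bounded values at each time converge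
  -- along it, and the estimates, being non-strict, pass to the limit.
  have hex : ∀ t, ∃ z, 0 ≤ t → Tendsto (y t) (hyperfilter ℕ : Filter ℕ) (𝓝 z) := fun t => by
    by_cases ht : 0 ≤ t
    · obtain ⟨z, -, hz⟩ := (isCompact_Icc (a := x₀ - t * M) (b := x₀ + t * M)).ultrafilter_le_nhds'
        ((hyperfilter ℕ).map (y t)) (by
          refine Ultrafilter.mem_map.2 (Filter.univ_mem' fun n => ?_)
          have h1 := hLip n 0 (N t n) (Nat.zero_le _)
          have h2 : |y t n - x₀| ≤ t * M := by
            refine h1.trans ?_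
            have := mul_le_mul_of_nonneg_right (hN1 t n ht) hM0
            simpa using this
          rw [abs_le] at h2
          exact ⟨by linarith, by linarith⟩)
      exact ⟨z, fun _ => hz⟩
    · exact ⟨0, fun h => absurd h ht⟩
  choose x hx using hex
  refine ⟨x, ?_, fun t ht => ?_⟩
  · refine tendsto_nhds_unique (hx 0 le_rfl) ?_
    have : y 0 = fun _ => x₀ := by ext n; simp [y, N, eulerScheme]
    rw [this]; exact tendsto_const_nhds
  have hNlim : ∀ t, 0 ≤ t → Tendsto (fun n => N t n * h n) (hyperfilter ℕ : Filter ℕ) (𝓝 t) :=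
    fun t ht => by
      refine Tendsto.mono_left ?_ Nat.hyperfilter_le_atTop
      have : Tendsto (fun n => t - h n) atTop (𝓝 (t - 0)) := tendsto_const_nhds.sub hlim
      rw [sub_zero] at this
      exact tendsto_of_tendsto_of_tendsto_of_le_of_le this tendsto_const_nhds
        (fun n => by have := hN2 t n; simp only; linarith) (fun n => hN1 t n ht)
  set c := F t (x t)
  -- An increment estimate for two points near `t`, which serves both sides of `t` at once.
  have key : ∀ η : ℝ, 0 < η → ∃ δ > 0, ∀ a b, 0 ≤ a → a ≤ b → |a - t| < δ → |b - t| < δ →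
      |x b - x a - (b - a) * c| ≤ (b - a) * η := by
    intro η hη
    obtain ⟨ρ, hρ, hFρ⟩ := Metric.continuousAt_iff.1 (hF.continuousAt (x := (t, x t))) η hη
    have hM1 : 0 < 4 * (M + 1) := by positivity
    -- With this radius, the grid nodes between `a` and `b` are within `2δ` of the node of `t`, and
    -- the scheme there is within `2δM + ρ/4 < ρ` of `x t`.
    refine ⟨ρ / (4 * (M + 1)), by positivity, fun a b ha hab hat hbt => ?_⟩
    set δ := ρ / (4 * (M + 1))
    have hδ : δ * M + δ = ρ / 4 := by simp only [δ]; field_simp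
    have hδ0 : 0 < δ := by positivity
    have hδM : 0 ≤ δ * M := by positivity
    have hb : 0 ≤ b := ha.trans hab
    refine le_of_tendsto_of_tendsto (((hx b hb).sub (hx a ha)).sub
      (((hNlim b hb).sub (hNlim a ha)).mul_const c)).abs
      (((hNlim b hb).sub (hNlim a ha)).mul_const η) ?_
    have e1 := (hlim.mono_left Nat.hyperfilter_le_atTop).eventually (gt_mem_nhds (half_pos hδ0))
    have e2 := (Metric.tendsto_nhds.1 (hx t ht)) (ρ / 4) (by positivity)
    filter_upwards [e1, e2] with n hn1 hn2
    have hNab : N a n ≤ N b n := Nat.floor_le_floor (by gcongr)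
    have := abs_eulerScheme_sub_le (F := F) (x₀ := x₀) (c := c) (r := η) (hpos n).le hNab
      fun k hak hkb => by
        have hk1 : a < k * h n + h n := (hN2 a n).trans_le (by gcongr)
        have hk2 : k * h n ≤ b := le_trans (by gcongr) (hN1 b n hb)
        rw [abs_lt] at hat hbt
        have hkt : |k * h n - N t n * h n| ≤ 2 * δ := by
          have := hN1 t n ht
          have := hN2 t n
          rw [abs_le]; constructor <;> linarith
        have hyk : |eulerScheme F x₀ (h n) k - y t n| ≤ 2 * (δ * M) := by
          have aux : |eulerScheme F x₀ (h n) k - y t n| ≤ |k * h n - N t n * h n| * M := by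
            rcases le_total k (N t n) with hk | hk
            · have hk' : (k : ℝ) * h n ≤ N t n * h n := by gcongr
              rw [abs_sub_comm, abs_sub_comm (k * h n), abs_of_nonneg (sub_nonneg.2 hk'), ← sub_mul]
              exact hLip n _ _ hk
            · have hk' : N t n * h n ≤ k * h n := by gcongr
              rw [abs_of_nonneg (sub_nonneg.2 hk'), ← sub_mul]
              exact hLip n _ _ hk
          have := mul_le_mul_of_nonneg_right hkt hM0
          linarith
        refine (hFρ (x := (k * h n, eulerScheme F x₀ (h n) k)) ?_).le
        rw [Prod.dist_eq, max_lt_iff]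
        constructor
        · rw [Real.dist_eq, abs_lt]
          constructor <;> simp only <;> linarith
        · refine (dist_triangle _ (y t n) _).trans_lt ?_
          rw [Real.dist_eq]
          simp only
          linarith
    simpa only [sub_mul] using this
  rw [hasDerivWithinAt_iff_isLittleO, Asymptotics.isLittleO_iff]
  intro η hη
  obtain ⟨δ, hδ, hδ'⟩ := key η hη
  filter_upwards [mem_nhdsWithin_of_mem_nhds (Metric.ball_mem_nhds t hδ), self_mem_nhdsWithin]
    with s hs hs0
  rw [Metric.mem_ball, Real.dist_eq] at hs
  have htt : |t - t| < δ := by simpa using hδ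
  simp only [Real.norm_eq_abs, smul_eq_mul]
  rcases le_total s t with hst | hst
  · have := hδ' s t hs0 hst hs htt
    rw [abs_sub_comm s t, abs_of_nonneg (sub_nonneg.2 hst), ← abs_neg, mul_comm η]
    convert this using 2; ring
  · have := hδ' t s ht hst htt hs
    rwa [abs_of_nonneg (sub_nonneg.2 hst), mul_comm η]

/-! ### The running supremum of a continuous path. -/

section RunningSupremum

variable {η : ℝ → ℝ}

lemma bddAbove_image_Ico (hη : ContinuousOn η (Ici 0)) (x : ℝ) : BddAbove (η '' Ico 0 x) :=
  ((isCompact_Icc (b := x)).bddAbove_image (hη.mono Icc_subset_Ici_self)).mono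
    (image_mono Ico_subset_Icc_self)

@[simp] lemma S_zero : S η 0 = 0 := by simp [S]

/-- Continuity recovers the right end point that the half-open supremum omits; at `x = 0` the value
0 of the empty supremum agrees with `η 0`. -/
lemma le_S_of_mem_Icc (hη : ContinuousOn η (Ici 0)) (hη0 : η 0 = 0) {u x : ℝ}
    (hu : u ∈ Icc 0 x) : η u ≤ S η x := by
  rcases hu.2.lt_or_eq with h | rfl
  · exact le_csSup (bddAbove_image_Ico hη x) ⟨u, ⟨hu.1, h⟩, rfl⟩
  · rcases hu.1.eq_or_lt with rfl | h0
    · simp [hη0]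
    · have hc : ContinuousWithinAt η (Ico 0 u) u :=
        (hη u hu.1).mono (Ico_subset_Icc_self.trans Icc_subset_Ici_self)
      have : (𝓝[Ico 0 u] u).NeBot := by
        rw [← mem_closure_iff_nhdsWithin_neBot, closure_Ico h0.ne]
        exact hu
      refine le_of_tendsto hc ?_
      filter_upwards [self_mem_nhdsWithin] with v hv
      exact le_csSup (bddAbove_image_Ico hη u) ⟨v, hv, rfl⟩

lemma S_nonneg (hη : ContinuousOn η (Ici 0)) (hη0 : η 0 = 0) {x : ℝ} (hx : 0 ≤ x) : 0 ≤ S η x :=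
  hη0 ▸ le_S_of_mem_Icc hη hη0 (left_mem_Icc.2 hx)

lemma S_le_iff (hη : ContinuousOn η (Ici 0)) (hη0 : η 0 = 0) {x s : ℝ} (hx : 0 ≤ x) :
    S η x ≤ s ↔ ∀ u ∈ Icc 0 x, η u ≤ s := by
  refine ⟨fun h u hu => (le_S_of_mem_Icc hη hη0 hu).trans h, fun h => ?_⟩
  rcases hx.eq_or_lt with rfl | h0
  · have := h 0 (by simp)
    simpa [hη0] using this
  · refine csSup_le ⟨_, mem_image_of_mem _ (left_mem_Ico.2 h0)⟩ ?_
    rintro _ ⟨u, hu, rfl⟩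
    exact h u (Ico_subset_Icc_self hu)

lemma S_mono (hη : ContinuousOn η (Ici 0)) (hη0 : η 0 = 0) {x y : ℝ} (hx : 0 ≤ x) (hxy : x ≤ y) :
    S η x ≤ S η y :=
  (S_le_iff hη hη0 hx).2 fun _ hu => le_S_of_mem_Icc hη hη0 ⟨hu.1, hu.2.trans hxy⟩

/-- Rescaling time turns the supremum into one over the fixed compact interval [0, 1] of a jointly
continuous function. -/
lemma continuousOn_S (hη : ContinuousOn η (Ici 0)) (hη0 : η 0 = 0) :
    ContinuousOn (S η) (Ici 0) := by
  have hc : Continuous fun u => η (max 0 u) :=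
    hη.comp_continuous (by fun_prop) fun u => le_max_left 0 u
  have hs : Continuous fun x : ℝ => sSup ((fun u => η (max 0 (x * u))) '' Icc (0 : ℝ) 1) :=
    (isCompact_Icc (a := (0 : ℝ)) (b := 1)).continuous_sSup
      (f := fun x u => η (max 0 (x * u)))
      (hc.comp (by fun_prop : Continuous fun p : ℝ × ℝ => p.1 * p.2))
  refine hs.continuousOn.congr fun x (hx : 0 ≤ x) => ?_
  have hne : ((fun u => η (max 0 (x * u))) '' Icc (0 : ℝ) 1).Nonempty := ⟨_, 0, by simp, rfl⟩
  refine le_antisymm ((S_le_iff hη hη0 hx).2 fun u hu => ?_) (csSup_le hne ?_)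
  · rcases hx.eq_or_lt with rfl | h0
    · obtain rfl : u = 0 := le_antisymm hu.2 hu.1
      simp
    · refine le_csSup (isCompact_Icc.bddAbove_image ?_)
        ⟨u / x, ⟨div_nonneg hu.1 hx, div_le_one_of_le₀ hu.2 hx⟩, ?_⟩
      · exact (hc.comp (by fun_prop : Continuous fun u => x * u)).continuousOn
      · simp only [mul_div_cancel₀ u h0.ne', max_eq_right hu.1]
  · rintro _ ⟨u, hu, rfl⟩
    simp only [max_eq_right (mul_nonneg hx hu.1)]
    exact le_S_of_mem_Icc hη hη0 ⟨mul_nonneg hx hu.1, mul_le_of_le_one_right hx hu.2⟩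

end RunningSupremum

/-! ### Monotonicity of solutions and the two bounds. -/

section Solutions

variable {ω : ℝ → ℝ} {ε : ℝ} {T : EReal} {φ : ℝ → ℝ}

lemma mem_timeDomain_of_le {s t : ℝ} (ht : t ∈ timeDomain T) (h0 : 0 ≤ s) (hst : s ≤ t) :
    s ∈ timeDomain T :=
  ⟨h0, (EReal.coe_le_coe_iff.2 hst).trans_lt ht.2⟩

lemma drift_lt_drift (hε : 0 < ε) {s t x : ℝ} (h : s < t) : drift ω ε s x < drift ω ε t x := by
  unfold drift
  gcongr

namespace IsSolution

lemma zero_mem (h : IsSolution ω ε T φ) : (0 : ℝ) ∈ timeDomain T := ⟨le_rfl, h.pos⟩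

lemma continuousOn (h : IsSolution ω ε T φ) : ContinuousOn φ (timeDomain T) := fun t ht =>
  (h.hasDeriv t ht).continuousWithinAt.mono fun _ hs => hs.1

lemma hasDerivAt (h : IsSolution ω ε T φ) {t : ℝ} (ht : t ∈ timeDomain T) (h0 : 0 < t) :
    HasDerivAt φ (drift ω ε t (φ t)) t :=
  (h.hasDeriv t ht).hasDerivAt (Ici_mem_nhds h0)

/-- Comparison of the solution with its shift by `t - s`. The slopes are strictly ordered at every
contact point, so no Lipschitz condition on `ω` is needed. -/
lemma monotoneOn (h : IsSolution ω ε T φ) (hε : 0 < ε) : MonotoneOn φ (timeDomain T) := by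
  intro s hs t ht hst
  rcases hst.eq_or_lt with rfl | hst
  · exact le_rfl
  have hmem : ∀ x ∈ Icc 0 s, x ∈ timeDomain T := fun x hx => mem_timeDomain_of_le hs hx.1 hx.2
  have hmem' : ∀ x ∈ Icc 0 s, x + (t - s) ∈ timeDomain T := fun x hx =>
    mem_timeDomain_of_le ht (by linarith [hx.1]) (by linarith [hx.2])
  have hder : ∀ x ∈ Icc 0 s,
      HasDerivAt (fun x => φ (x + (t - s))) (drift ω ε (x + (t - s)) (φ (x + (t - s)))) x :=
    fun x hx => (h.hasDerivAt (hmem' x hx) (by linarith [hx.1])).comp_add_const x (t - s)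
  have key := image_le_of_deriv_right_lt_deriv_boundary' (f := φ) (a := 0) (b := s)
    (f' := fun x => drift ω ε x (φ x)) (B := fun x => φ (x + (t - s)))
    (B' := fun x => drift ω ε (x + (t - s)) (φ (x + (t - s))))
    (h.continuousOn.mono hmem)
    (fun x hx => (h.hasDeriv x (hmem x (Ico_subset_Icc_self hx))).mono (Ici_subset_Ici.2 hx.1))
    (by rw [h.init]; exact h.nonneg _ (hmem' 0 ⟨le_rfl, hs.1⟩))
    (fun x hx => (hder x hx).continuousAt.continuousWithinAt)
    (fun x hx => (hder x (Ico_subset_Icc_self hx)).hasDerivWithinAt)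
    (fun x _ hxe => by
      rw [← hxe]
      exact drift_lt_drift hε (by linarith))
  have := key (right_mem_Icc.2 hs.1)
  simpa using this

/-- On an interval where the solution is constant its drift would vanish, yet the drift at a fixed
level increases strictly with time. -/
lemma strictMonoOn (h : IsSolution ω ε T φ) (hε : 0 < ε) : StrictMonoOn φ (timeDomain T) := by
  intro a ha b hb hab
  refine (h.monotoneOn hε ha hb hab.le).lt_of_ne fun heq => ?_
  have hconst : ∀ m ∈ Ioo a b, drift ω ε m (φ a) = 0 := fun m hm => by
    have hcm : ∀ m ∈ Ioo a b, φ m = φ a := fun m hm => by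
      have hmT := mem_timeDomain_of_le hb (ha.1.trans hm.1.le) hm.2.le
      exact le_antisymm ((h.monotoneOn hε hmT hb hm.2.le).trans heq.ge)
        (h.monotoneOn hε ha hmT hm.1.le)
    have hd := h.hasDerivAt (mem_timeDomain_of_le hb (ha.1.trans hm.1.le) hm.2.le)
      (ha.1.trans_lt hm.1)
    rw [hcm m hm] at hd
    refine hd.unique ((hasDerivAt_const m (φ a)).congr_of_eventuallyEq ?_)
    filter_upwards [Ioo_mem_nhds hm.1 hm.2] with x hx using hcm x hx
  obtain ⟨m, hm⟩ := exists_between hab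
  obtain ⟨n, hn⟩ := exists_between hm.2
  have := drift_lt_drift (ω := ω) (x := φ a) hε hn.1
  rw [hconst m hm, hconst n ⟨hm.1.trans hn.1, hn.2⟩] at this
  exact this.false

lemma drift_nonneg (h : IsSolution ω ε T φ) (hε : 0 < ε) (hω0 : ω 0 = 0) {t : ℝ}
    (ht : t ∈ timeDomain T) : 0 ≤ drift ω ε t (φ t) := by
  rcases ht.1.eq_or_lt with rfl | h0
  · simp [drift, h.init, hω0]
  have hd := (h.hasDerivAt ht h0).hasDerivWithinAt (s := Iio t)
  rw [hasDerivWithinAt_iff_tendsto_slope' (by simp)] at hd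
  refine ge_of_tendsto hd ?_
  filter_upwards [Ioo_mem_nhdsLT h0] with s hs
  rw [slope_comm, slope_def_field]
  exact div_nonneg (sub_nonneg.2 (h.monotoneOn hε
    (mem_timeDomain_of_le ht hs.1.le hs.2.le) ht hs.2.le)) (sub_nonneg.2 hs.2.le)

/-- Each level up to `φ t` is attained at some `s ≤ t`, and nonnegativity of the drift there bounds
`u - ω u` by `s + ε`. -/
lemma S_sub_le (h : IsSolution ω ε T φ) (hε : 0 < ε) (hω : ContinuousOn ω (Ici 0))
    (hω0 : ω 0 = 0) {t : ℝ} (ht : t ∈ timeDomain T) : S (fun u => u - ω u) (φ t) - ε ≤ t := by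
  rw [sub_le_iff_le_add]
  refine (S_le_iff (η := fun u => u - ω u) (continuousOn_id.sub hω) (by simp [hω0]) (h.nonneg t ht)).2 fun u hu => ?_
  obtain ⟨s, hs, rfl⟩ := intermediate_value_Icc ht.1
    (h.continuousOn.mono fun s hs => mem_timeDomain_of_le ht hs.1 hs.2) (h.init.symm ▸ hu)
  have := h.drift_nonneg hε hω0 (mem_timeDomain_of_le ht hs.1 hs.2)
  unfold drift at this
  have h2 : 0 ≤ ε * (ε⁻¹ * (ω (φ s) + s - φ s) + 1) := by positivity
  have h3 : ε * (ε⁻¹ * (ω (φ s) + s - φ s) + 1) = ω (φ s) + s - φ s + ε := by field_simp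
  linarith [hs.2]

/-- After time `a` the drift is at least `(s - a) / ε`, so the solution outgrows the parabola `(s -
a) ^ 2 / (2 * ε)`. -/
lemma le_S_add (h : IsSolution ω ε T φ) (hε : 0 < ε) (hω : ContinuousOn ω (Ici 0))
    (hω0 : ω 0 = 0) {t : ℝ} (ht : t ∈ timeDomain T) :
    t ≤ S (fun u => u - ω u) (φ t) + 2 * √(φ t * ε) := by
  have hη : ContinuousOn (fun u => u - ω u) (Ici 0) := continuousOn_id.sub hω
  have hη0 : (0 : ℝ) - ω 0 = 0 := by simp [hω0]
  set a := S (fun u => u - ω u) (φ t) with ha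
  have ha0 : 0 ≤ a := S_nonneg hη hη0 (h.nonneg t ht)
  rcases le_total t a with hta | hat
  · have := Real.sqrt_nonneg (φ t * ε)
    linarith
  have hmem : ∀ s ∈ Icc a t, s ∈ timeDomain T := fun s hs =>
    mem_timeDomain_of_le ht (ha0.trans hs.1) hs.2
  have hmono : MonotoneOn (fun s => φ s - (s - a) ^ 2 / (2 * ε)) (Icc a t) := by
    have hd : ∀ s ∈ Ioo a t, HasDerivAt (fun s => φ s - (s - a) ^ 2 / (2 * ε))
        (drift ω ε s (φ s) - (s - a) / ε) s := fun s hs => by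
      have h1 := h.hasDerivAt (hmem s (Ioo_subset_Icc_self hs)) (ha0.trans_lt hs.1)
      have h2 := ((((hasDerivAt_id s).sub_const a).pow 2).div_const (2 * ε))
      refine (h1.sub h2).congr_deriv ?_
      simp only [id]
      field_simp
      push_cast
      ring
    refine monotoneOn_of_deriv_nonneg (convex_Icc a t)
      ((h.continuousOn.mono hmem).sub (by fun_prop)) ?_ ?_
    · rw [interior_Icc]
      exact fun s hs => (hd s hs).differentiableAt.differentiableWithinAt
    · rw [interior_Icc]
      intro s hs
      rw [(hd s hs).deriv]
      have hsT := hmem s (Ioo_subset_Icc_self hs)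
      have h1 : φ s - ω (φ s) ≤ a := le_S_of_mem_Icc hη hη0
        ⟨h.nonneg s hsT, h.monotoneOn hε hsT ht hs.2.le⟩
      have h2 : drift ω ε s (φ s) - (s - a) / ε = (a - (φ s - ω (φ s))) / ε + 1 := by
        unfold drift; field_simp; ring
      rw [h2]
      have : 0 ≤ a - (φ s - ω (φ s)) := by linarith
      positivity
  have h1 := hmono (left_mem_Icc.2 hat) (right_mem_Icc.2 hat) hat
  have h2 := h.nonneg a (hmem a (left_mem_Icc.2 hat))
  have h3 : (t - a) ^ 2 / (2 * ε) ≤ φ t := by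
    simp only [sub_self] at h1
    have : (0 : ℝ) ^ 2 / (2 * ε) = 0 := by simp
    linarith
  rw [div_le_iff₀ (by positivity)] at h3
  have h4 : 0 ≤ φ t * ε := mul_nonneg (h.nonneg t ht) hε.le
  -- There is slack here: the parabola would give the constant √2 in place of 2.
  have h5 : (t - a) / 2 ≤ √(φ t * ε) := Real.le_sqrt_of_sq_le (by nlinarith)
  linarith

end IsSolution

/-! ### Continuation of bounded solutions, and surjectivity. -/

/-- A bounded solution on a finite time interval can be continued. -/
lemma IsSolution.exists_extension (h : IsSolution ω ε T φ) (hε : 0 < ε)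
    (hω : ContinuousOn ω (Ici 0)) {τ : ℝ} (hT : T = τ) {M : ℝ}
    (hM : ∀ t ∈ timeDomain T, φ t ≤ M) :
    ∃ (T' : EReal) (ψ : ℝ → ℝ), IsSolution ω ε T' ψ ∧ T < T' ∧ EqOn ψ φ (timeDomain T) := by
  subst hT
  have hτ : 0 < τ := EReal.coe_pos.1 h.pos
  have hdom : ∀ t, t ∈ timeDomain (τ : EReal) ↔ 0 ≤ t ∧ t < τ := fun t => by
    simp [timeDomain]
  -- Positivity of the limit matters: the continuation starts away from 0 and so stays nonnegative
  -- for a short time.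
  obtain ⟨z, hz, hz0⟩ : ∃ z, Tendsto φ (𝓝[<] τ) (𝓝 z) ∧ 0 < z := by
    have hsub : Ioo 0 τ ⊆ timeDomain (τ : EReal) := fun t ht => (hdom t).2 ⟨ht.1.le, ht.2⟩
    have hb : BddAbove (φ '' Ioo 0 τ) := ⟨M, by rintro _ ⟨t, ht, rfl⟩; exact hM t (hsub ht)⟩
    refine ⟨_, MonotoneOn.tendsto_nhdsWithin_Ioo_left (nonempty_Ioo.2 hτ)
      ((h.monotoneOn hε).mono hsub) hb, ?_⟩
    have hm : τ / 2 ∈ Ioo 0 τ := ⟨by linarith, by linarith⟩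
    refine lt_of_lt_of_le ?_ (le_csSup hb ⟨τ / 2, hm, rfl⟩)
    have := h.strictMonoOn hε h.zero_mem (hsub hm) hm.1
    rwa [h.init] at this
  -- continuation beyond the end point
  obtain ⟨χ, δ, hδ, hχ0, hχpos, hχ⟩ : ∃ (χ : ℝ → ℝ) (δ : ℝ), 0 < δ ∧ χ 0 = z ∧
      (∀ s ∈ Ico 0 δ, 0 ≤ χ s) ∧
      ∀ s ∈ Ico 0 δ, HasDerivWithinAt χ (drift ω ε (τ + s) (χ s)) (Ici 0) s := by
    -- Clamping time to [0, 1] and space to [0, 2z] makes the right-hand side bounded and globally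
    -- continuous; the clamps are inactive as long as the solution from `z` remains in (0, 2z).
    let c : ℝ → ℝ → ℝ := fun b x => max 0 (min b x)
    have hc : ∀ b, Continuous (c b) := fun b => by fun_prop
    have hcm : ∀ b, 0 ≤ b → ∀ x, c b x ∈ Icc 0 b := fun b hb x =>
      ⟨le_max_left _ _, max_le hb (min_le_left _ _)⟩
    have hcid : ∀ b x, x ∈ Icc 0 b → c b x = x := fun b x hx => by
      simp only [c, min_eq_right hx.2, max_eq_right hx.1]
    have hG : ContinuousOn (fun p : ℝ × ℝ => drift ω ε (τ + p.1) p.2) (Icc 0 1 ×ˢ Icc 0 (2 * z)) := by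
      have : ContinuousOn (fun p : ℝ × ℝ => ω p.2) (Icc 0 1 ×ˢ Icc 0 (2 * z)) :=
        hω.comp continuousOn_snd fun p hp => hp.2.1
      exact ((this.add (by fun_prop)).sub continuousOn_snd).const_mul ε⁻¹ |>.add continuousOn_const
    obtain ⟨C, hC⟩ := (isCompact_Icc.prod isCompact_Icc).exists_bound_of_continuousOn hG
    have hmaps : ∀ s x, (c 1 s, c (2 * z) x) ∈ Icc (0 : ℝ) 1 ×ˢ Icc 0 (2 * z) := fun s x =>
      ⟨hcm 1 zero_le_one s, hcm (2 * z) (by linarith) x⟩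
    obtain ⟨χ, hχ0, hχ⟩ := exists_hasDerivWithinAt_of_continuous_bounded
      (F := fun s x => drift ω ε (τ + c 1 s) (c (2 * z) x)) (M := C)
      (hG.comp_continuous (f := fun p : ℝ × ℝ => (c 1 p.1, c (2 * z) p.2)) (by fun_prop)
        fun p => hmaps p.1 p.2)
      (fun s x => hC _ (hmaps s x)) z
    have hev : ∀ᶠ s in 𝓝[≥] (0 : ℝ), χ s ∈ Ioo 0 (2 * z) := by
      have := (hχ 0 le_rfl).continuousWithinAt
      refine this (Ioo_mem_nhds ?_ ?_) <;> rw [hχ0] <;> linarith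
    obtain ⟨d, hd, hdsub⟩ := mem_nhdsGE_iff_exists_Ico_subset.1 hev
    refine ⟨χ, min d 1, lt_min hd one_pos, hχ0, fun s hs => ?_, fun s hs => ?_⟩
    · exact (hdsub ⟨hs.1, hs.2.trans_le (min_le_left _ _)⟩).1.le
    · have h1 := hχ s hs.1
      have h2 := hdsub ⟨hs.1, hs.2.trans_le (min_le_left _ _)⟩
      rwa [hcid 1 s ⟨hs.1, (hs.2.trans_le (min_le_right _ _)).le⟩,
        hcid _ _ (Ioo_subset_Icc_self h2)] at h1
  let ψ : ℝ → ℝ := fun t => if t < τ then φ t else χ (t - τ)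
  have hψl : ∀ t, t < τ → ψ t = φ t := fun t ht => if_pos ht
  have hψr : ∀ t, τ ≤ t → ψ t = χ (t - τ) := fun t ht => if_neg ht.not_gt
  have hψd : ∀ t, 0 < t → t < τ → HasDerivAt ψ (drift ω ε t (φ t)) t := fun t h0 ht => by
    refine (h.hasDerivAt ((hdom t).2 ⟨h0.le, ht⟩) h0).congr_of_eventuallyEq ?_
    filter_upwards [Iio_mem_nhds ht] with s hs using hψl s hs
  refine ⟨((τ + δ : ℝ) : EReal), ψ, ⟨?_, ?_, ?_, ?_⟩, EReal.coe_lt_coe_iff.2 (by linarith), ?_⟩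
  · exact EReal.coe_pos.2 (by linarith)
  · rw [hψl 0 hτ, h.init]
  · intro t ht
    rcases lt_or_ge t τ with htτ | htτ
    · rw [hψl t htτ]
      exact h.nonneg t ((hdom t).2 ⟨ht.1, htτ⟩)
    · rw [hψr t htτ]
      have := EReal.coe_lt_coe_iff.1 ht.2
      exact hχpos _ ⟨by linarith, by linarith⟩
  · intro t ht
    have htδ := EReal.coe_lt_coe_iff.1 ht.2
    rcases lt_trichotomy t τ with htτ | rfl | htτ
    · rw [hψl t htτ]
      refine (h.hasDeriv t ((hdom t).2 ⟨ht.1, htτ⟩)).congr_of_eventuallyEq ?_ (hψl t htτ)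
      filter_upwards [mem_nhdsWithin_of_mem_nhds (Iio_mem_nhds htτ)] with s hs using hψl s hs
    · have hψt : ψ t = z := by rw [hψr t le_rfl, sub_self, hχ0]
      have hR : HasDerivWithinAt ψ (drift ω ε t z) (Ici t) t := by
        have h1 := hχ 0 ⟨le_rfl, hδ⟩
        rw [add_zero, hχ0] at h1
        have h2 : HasDerivWithinAt (fun s => χ (s - t)) (drift ω ε t z) (Ici t) t := by
          have h3 := HasDerivWithinAt.scomp_of_eq (h := fun s => s - t) (h' := 1) (s := Ici t) t h1
            ((hasDerivAt_id t).sub_const t).hasDerivWithinAt (fun s (hs : t ≤ s) => mem_Ici.2 (sub_nonneg.2 hs)) (by simp)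
          rw [one_smul] at h3
          exact h3
        exact h2.congr (fun s hs => hψr s hs) (hψr t le_rfl)
      -- At the junction, the left derivative is the limit of the derivatives from the left.
      have hL : HasDerivWithinAt ψ (drift ω ε t z) (Iic t) t := by
        refine hasDerivWithinAt_Iic_of_tendsto_deriv (s := Ioo 0 t)
          (fun s hs => (hψd s hs.1 hs.2).differentiableAt.differentiableWithinAt) ?_
          (Ioo_mem_nhdsLT hτ) ?_
        · have h1 : Tendsto φ (𝓝[Ioo 0 t] t) (𝓝 z) := hz.mono_left (nhdsWithin_mono _ fun s hs => hs.2)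
          unfold ContinuousWithinAt
          rw [hψt]
          refine h1.congr' ?_
          filter_upwards [self_mem_nhdsWithin] with s hs using (hψl s hs.2).symm
        · have h1 : Tendsto (fun s => drift ω ε s (φ s)) (𝓝[<] t) (𝓝 (drift ω ε t z)) := by
            have h2 : Tendsto (fun s => ω (φ s)) (𝓝[<] t) (𝓝 (ω z)) :=
              ((hω z hz0.le).continuousAt (Ici_mem_nhds hz0)).tendsto.comp hz
            have h3 : Tendsto (fun s : ℝ => s) (𝓝[<] t) (𝓝 t) := tendsto_id.mono_left nhdsWithin_le_nhds
            exact (((h2.add h3).sub hz).const_mul _).add_const 1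
          refine h1.congr' ?_
          filter_upwards [Ioo_mem_nhdsLT hτ] with s hs using (hψd s hs.1 hs.2).deriv.symm
      have := hL.union hR
      rw [Iic_union_Ici] at this
      rw [hψt]
      exact this.mono (subset_univ _)
    · have h1 := hχ (t - τ) ⟨by linarith, by linarith⟩
      rw [add_sub_cancel] at h1
      have h2 := (h1.hasDerivAt (Ici_mem_nhds (by linarith))).comp_sub_const t τ
      rw [hψr t htτ.le]
      refine (h2.congr_of_eventuallyEq ?_).hasDerivWithinAt
      filter_upwards [Ioi_mem_nhds htτ] with s hs using hψr s (le_of_lt hs)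
  · exact fun t ht => hψl t ((hdom t).1 ht).2

namespace IsMaximalSolution

lemma exists_lt (h : IsMaximalSolution ω ε T φ) (hε : 0 < ε) (hω : ContinuousOn ω (Ici 0))
    (hω0 : ω 0 = 0) (M : ℝ) : ∃ t ∈ timeDomain T, M < φ t := by
  by_contra! hM
  have hs := h.isSolution
  induction T with
  | bot => exact absurd hs.pos (by simp)
  | coe τ =>
    obtain ⟨T', ψ, hψ, hlt, heq⟩ := hs.exists_extension hε hω rfl hM
    exact (h.maximal T' ψ hψ hlt.le heq).not_gt hlt
  | top =>
    have hη : ContinuousOn (fun u => u - ω u) (Ici 0) := continuousOn_id.sub hω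
    have hη0 : (0 : ℝ) - ω 0 = 0 := by simp [hω0]
    have hM0 : 0 ≤ M := hs.init ▸ hM 0 hs.zero_mem
    have hS := S_nonneg hη hη0 hM0
    -- A time exceeding by 1 the upper bound for the passage to level `M`.
    set t := S (fun u => u - ω u) M + 2 * √(M * ε) + 1
    have ht : t ∈ timeDomain ⊤ := ⟨by positivity, EReal.coe_lt_top _⟩
    have h1 := hs.le_S_add hε hω hω0 ht
    have h2 := S_mono hη hη0 (hs.nonneg t ht) (hM t ht)
    have h3 : √(φ t * ε) ≤ √(M * ε) := by
      gcongr
      exact hM t ht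
    have h4 : t = S (fun u => u - ω u) M + 2 * √(M * ε) + 1 := rfl
    linarith

lemma bijOn (h : IsMaximalSolution ω ε T φ) (hε : 0 < ε) (hω : ContinuousOn ω (Ici 0))
    (hω0 : ω 0 = 0) : BijOn φ (timeDomain T) (Ici 0) := by
  refine ⟨h.isSolution.nonneg, (h.isSolution.strictMonoOn hε).injOn, fun y hy => ?_⟩
  obtain ⟨t, ht, hyt⟩ := h.exists_lt hε hω hω0 y
  obtain ⟨s, hs, rfl⟩ := intermediate_value_Icc ht.1
    (h.isSolution.continuousOn.mono fun s hs => mem_timeDomain_of_le ht hs.1 hs.2)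
    (show y ∈ Icc (φ 0) (φ t) from ⟨h.isSolution.init.symm ▸ hy, hyt.le⟩)
  exact ⟨s, mem_timeDomain_of_le ht hs.1 hs.2, rfl⟩

end IsMaximalSolution

lemma IsSolution.E_apply (h : IsSolution ω ε T φ) (hε : 0 < ε) {t : ℝ} (ht : t ∈ timeDomain T) :
    E T φ (φ t) = t := by
  refine le_antisymm (le_of_forall_gt fun c hc => ?_) (le_sInf ?_)
  · obtain ⟨r, htr, hr⟩ := EReal.lt_iff_exists_real_btwn.1 (lt_min hc ht.2)
    have htr' := EReal.coe_lt_coe_iff.1 htr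
    have hrT := hr.trans_le (min_le_right _ _)
    refine (sInf_le ?_).trans_lt (hr.trans_le (min_le_left _ _))
    exact ⟨r, ⟨ht.1.trans_lt htr', hrT, h.strictMonoOn hε ht ⟨(ht.1.trans_lt htr').le, hrT⟩ htr'⟩, rfl⟩
  · rintro _ ⟨u, ⟨hu0, huT, hu⟩, rfl⟩
    exact EReal.coe_le_coe_iff.2 (((h.strictMonoOn hε).lt_iff_lt ht ⟨hu0.le, huT⟩).1 hu).le

end Solutions

/-! ### The exit time of a maximal solution as a continuous inverse. -/

lemma timeDomain_mem_nhdsGE {T : EReal} {t : ℝ} (ht : t ∈ timeDomain T) :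
    timeDomain T ∈ 𝓝[≥] t := by
  have h1 : ∀ᶠ s : ℝ in 𝓝 t, (s : EReal) < T :=
    continuous_coe_real_ereal.continuousAt.eventually (gt_mem_nhds ht.2)
  filter_upwards [self_mem_nhdsWithin, mem_nhdsWithin_of_mem_nhds h1] with s hs hsT
  exact ⟨ht.1.trans hs, hsT⟩

lemma timeDomain_mem_nhds {T : EReal} {t : ℝ} (ht : t ∈ timeDomain T) (h0 : 0 < t) :
    timeDomain T ∈ 𝓝 t := by
  have h1 : ∀ᶠ s : ℝ in 𝓝 t, (s : EReal) < T :=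
    continuous_coe_real_ereal.continuousAt.eventually (gt_mem_nhds ht.2)
  filter_upwards [lt_mem_nhds h0, h1] with s hs hsT
  exact ⟨hs.le, hsT⟩

namespace IsMaximalSolution

variable {ω : ℝ → ℝ} {ε : ℝ} {T : EReal} {φ : ℝ → ℝ}

lemma exists_eq (h : IsMaximalSolution ω ε T φ) (hε : 0 < ε) (hω : ContinuousOn ω (Ici 0))
    (hω0 : ω 0 = 0) {x : ℝ} (hx : 0 ≤ x) : ∃ t ∈ timeDomain T, φ t = x ∧ E T φ x = t := by
  obtain ⟨t, ht, rfl⟩ := (h.bijOn hε hω hω0).surjOn hx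
  exact ⟨t, ht, rfl, h.isSolution.E_apply hε ht⟩

lemma toReal_E_mem (h : IsMaximalSolution ω ε T φ) (hε : 0 < ε) (hω : ContinuousOn ω (Ici 0))
    (hω0 : ω 0 = 0) {x : ℝ} (hx : 0 ≤ x) : (E T φ x).toReal ∈ timeDomain T := by
  obtain ⟨t, ht, -, hE⟩ := h.exists_eq hε hω hω0 hx
  rwa [hE, EReal.toReal_coe]

lemma apply_toReal_E (h : IsMaximalSolution ω ε T φ) (hε : 0 < ε) (hω : ContinuousOn ω (Ici 0))
    (hω0 : ω 0 = 0) {x : ℝ} (hx : 0 ≤ x) : φ (E T φ x).toReal = x := by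
  obtain ⟨t, ht, hφ, hE⟩ := h.exists_eq hε hω hω0 hx
  rwa [hE, EReal.toReal_coe]

lemma toReal_E_apply (h : IsMaximalSolution ω ε T φ) (hε : 0 < ε) {t : ℝ}
    (ht : t ∈ timeDomain T) : (E T φ (φ t)).toReal = t := by
  rw [h.isSolution.E_apply hε ht, EReal.toReal_coe]

lemma toReal_E_lt_iff (h : IsMaximalSolution ω ε T φ) (hε : 0 < ε) (hω : ContinuousOn ω (Ici 0))
    (hω0 : ω 0 = 0) {x t : ℝ} (hx : 0 ≤ x) (ht : t ∈ timeDomain T) :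
    (E T φ x).toReal < t ↔ x < φ t := by
  rw [← (h.isSolution.strictMonoOn hε).lt_iff_lt (h.toReal_E_mem hε hω hω0 hx) ht,
    h.apply_toReal_E hε hω hω0 hx]

lemma lt_toReal_E_iff (h : IsMaximalSolution ω ε T φ) (hε : 0 < ε) (hω : ContinuousOn ω (Ici 0))
    (hω0 : ω 0 = 0) {x t : ℝ} (hx : 0 ≤ x) (ht : t ∈ timeDomain T) :
    t < (E T φ x).toReal ↔ φ t < x := by
  rw [← (h.isSolution.strictMonoOn hε).lt_iff_lt ht (h.toReal_E_mem hε hω hω0 hx),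
    h.apply_toReal_E hε hω hω0 hx]

lemma monotoneOn_toReal_E (h : IsMaximalSolution ω ε T φ) (hε : 0 < ε)
    (hω : ContinuousOn ω (Ici 0)) (hω0 : ω 0 = 0) :
    MonotoneOn (fun x => (E T φ x).toReal) (Ici 0) := fun x hx y hy hxy => by
  rw [← (h.isSolution.strictMonoOn hε).le_iff_le (h.toReal_E_mem hε hω hω0 hx)
    (h.toReal_E_mem hε hω hω0 hy), h.apply_toReal_E hε hω hω0 hx, h.apply_toReal_E hε hω hω0 hy]
  exact hxy

/-- A monotone function whose image contains a neighbourhood of its value cannot jump; here the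
image contains the whole time domain. -/
lemma continuousOn_toReal_E (h : IsMaximalSolution ω ε T φ) (hε : 0 < ε)
    (hω : ContinuousOn ω (Ici 0)) (hω0 : ω 0 = 0) :
    ContinuousOn (fun x => (E T φ x).toReal) (Ici 0) := by
  have hsub : timeDomain T ⊆ (fun x => (E T φ x).toReal) '' Ici 0 := fun t ht =>
    ⟨φ t, h.isSolution.nonneg t ht, h.toReal_E_apply hε ht⟩
  intro x hx
  have hmem := h.toReal_E_mem hε hω hω0 hx
  rcases (mem_Ici.1 hx).eq_or_lt with rfl | h0
  · exact continuousWithinAt_right_of_monotoneOn_of_image_mem_nhdsWithin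
      (h.monotoneOn_toReal_E hε hω hω0) self_mem_nhdsWithin
      (mem_of_superset (timeDomain_mem_nhdsGE hmem) hsub)
  · refine (continuousAt_of_monotoneOn_of_image_mem_nhds
      (h.monotoneOn_toReal_E hε hω hω0) (Ici_mem_nhds h0)
      (mem_of_superset (timeDomain_mem_nhds hmem ?_) hsub)).continuousWithinAt
    rw [h.lt_toReal_E_iff hε hω hω0 hx h.isSolution.zero_mem, h.isSolution.init]
    exact h0

lemma E_bounds (h : IsMaximalSolution ω ε T φ) (hε : 0 < ε)
    (hω : ContinuousOn ω (Ici 0)) (hω0 : ω 0 = 0) {x : ℝ} (hx : 0 ≤ x) :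
    ((S (fun u => u - ω u) x - ε : ℝ) : EReal) ≤ E T φ x ∧
      E T φ x ≤ ((S (fun u => u - ω u) x + 2 * √(x * ε) : ℝ) : EReal) := by
  obtain ⟨t, ht, rfl, hE⟩ := h.exists_eq hε hω hω0 hx
  rw [hE]
  exact ⟨EReal.coe_le_coe_iff.2 (h.isSolution.S_sub_le hε hω hω0 ht),
    EReal.coe_le_coe_iff.2 (h.isSolution.le_S_add hε hω hω0 ht)⟩

lemma abs_toReal_E_sub_S_le (h : IsMaximalSolution ω ε T φ) (hε : 0 < ε)
    (hω : ContinuousOn ω (Ici 0)) (hω0 : ω 0 = 0) {x K : ℝ} (hx : 0 ≤ x) (hxK : x ≤ K) :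
    |(E T φ x).toReal - S (fun u => u - ω u) x| ≤ ε + 2 * √(K * ε) := by
  obtain ⟨t, ht, rfl, hE⟩ := h.exists_eq hε hω hω0 hx
  have h1 := h.isSolution.S_sub_le hε hω hω0 ht
  have h2 := h.isSolution.le_S_add hε hω hω0 ht
  have h3 : √(φ t * ε) ≤ √(K * ε) := by gcongr
  have h4 := Real.sqrt_nonneg (K * ε)
  rw [hE, EReal.toReal_coe, abs_le]
  constructor <;> linarith

end IsMaximalSolution

lemma tendsto_error_bound (K : ℝ) :
    Tendsto (fun ε : ℝ => ε + 2 * √(K * ε)) (𝓝[>] 0) (𝓝 0) := by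
  have : Continuous fun ε : ℝ => ε + 2 * √(K * ε) := by fun_prop
  simpa using (this.tendsto 0).mono_left nhdsWithin_le_nhds

/-! ### The exit time of the limit path and its completed graph. -/

section ExitTime

variable {η : ℝ → ℝ} {t : ℝ}

lemma exists_lt_of_mem_timeDomain_SInfty (hη0 : η 0 = 0) (ht : t ∈ timeDomain (SInfty η)) :
    ∃ u, 0 < u ∧ t < η u := by
  obtain ⟨u, hu⟩ := lt_iSup_iff.1 ht.2
  obtain ⟨hu0, htu⟩ := lt_iSup_iff.1 hu
  have htu := EReal.coe_lt_coe_iff.1 htu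
  refine ⟨u, (mem_Ici.1 hu0).lt_of_ne' ?_, htu⟩
  rintro rfl
  exact (ht.1.trans_lt htu).ne' hη0

lemma E_top_ne_top (hη0 : η 0 = 0) (ht : t ∈ timeDomain (SInfty η)) : E ⊤ η t ≠ ⊤ := by
  obtain ⟨u, hu0, hu⟩ := exists_lt_of_mem_timeDomain_SInfty hη0 ht
  have : E ⊤ η t ≤ u := sInf_le ⟨u, ⟨hu0, EReal.coe_lt_top u, hu⟩, rfl⟩
  exact (this.trans_lt (EReal.coe_lt_top u)).ne

lemma zero_le_E (T : EReal) (η : ℝ → ℝ) (t : ℝ) : 0 ≤ E T η t := by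
  refine le_sInf ?_
  rintro _ ⟨u, hu, rfl⟩
  exact EReal.coe_nonneg.2 hu.1.le

lemma toReal_E_nonneg (T : EReal) (η : ℝ → ℝ) (t : ℝ) : 0 ≤ (E T η t).toReal :=
  EReal.toReal_nonneg (zero_le_E T η t)

/-- The exit time is the right-continuous inverse of the running supremum. -/
lemma le_toReal_E_top_iff (hη : ContinuousOn η (Ici 0)) (hη0 : η 0 = 0)
    (ht : t ∈ timeDomain (SInfty η)) {z : ℝ} (hz : 0 ≤ z) :
    z ≤ (E ⊤ η t).toReal ↔ S η z ≤ t := by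
  have hbot : E ⊤ η t ≠ ⊥ := (EReal.bot_lt_zero.trans_le (zero_le_E ⊤ η t)).ne'
  rw [← EReal.coe_le_coe_iff, EReal.coe_toReal (E_top_ne_top hη0 ht) hbot, E, le_sInf_iff]
  constructor
  · intro h
    rcases hz.eq_or_lt with rfl | hz0
    · simpa using ht.1
    refine csSup_le ⟨_, mem_image_of_mem _ (left_mem_Ico.2 hz0)⟩ ?_
    rintro _ ⟨u, hu, rfl⟩
    by_contra! htu
    rcases hu.1.eq_or_lt with rfl | hu0
    · exact (ht.1.trans_lt htu).ne' hη0
    · exact (EReal.coe_le_coe_iff.1 (h u ⟨u, ⟨hu0, EReal.coe_lt_top u, htu⟩, rfl⟩)).not_gt hu.2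
  · rintro h _ ⟨u, ⟨hu0, -, htu⟩, rfl⟩
    refine EReal.coe_le_coe_iff.2 (le_of_not_gt fun huz => ?_)
    exact ((le_S_of_mem_Icc hη hη0 ⟨hu0.le, huz.le⟩).trans h).not_gt htu

lemma toReal_E_top_lt_iff (hη : ContinuousOn η (Ici 0)) (hη0 : η 0 = 0)
    (ht : t ∈ timeDomain (SInfty η)) {z : ℝ} (hz : 0 ≤ z) :
    (E ⊤ η t).toReal < z ↔ t < S η z := by
  rw [← not_le, le_toReal_E_top_iff hη hη0 ht hz, not_le]

/-- Beyond the exit time the supremum exceeds `t`; continuity of the supremum excludes a jump there.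
-/
lemma S_toReal_E_top (hη : ContinuousOn η (Ici 0)) (hη0 : η 0 = 0)
    (ht : t ∈ timeDomain (SInfty η)) : S η (E ⊤ η t).toReal = t := by
  have h0 := toReal_E_nonneg ⊤ η t
  refine le_antisymm ((le_toReal_E_top_iff hη hη0 ht h0).1 le_rfl) ?_
  have hc : Tendsto (S η) (𝓝[>] (E ⊤ η t).toReal) (𝓝 (S η (E ⊤ η t).toReal)) :=
    (continuousOn_S hη hη0 _ h0).mono fun z (hz : _ < z) => h0.trans hz.le
  refine ge_of_tendsto hc ?_
  filter_upwards [self_mem_nhdsWithin] with z hz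
  exact ((toReal_E_top_lt_iff hη hη0 ht (h0.trans (le_of_lt hz))).1 hz).le

lemma monotoneOn_toReal_E_top (hη : ContinuousOn η (Ici 0)) (hη0 : η 0 = 0) :
    MonotoneOn (fun t => (E ⊤ η t).toReal) (timeDomain (SInfty η)) := fun s hs t ht hst => by
  rw [le_toReal_E_top_iff hη hη0 ht (toReal_E_nonneg _ _ _), S_toReal_E_top hη hη0 hs]
  exact hst

lemma tendsto_toReal_E_top_nhdsLT (hη : ContinuousOn η (Ici 0)) (hη0 : η 0 = 0)
    (ht : t ∈ timeDomain (SInfty η)) (h0 : 0 < t) :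
    Tendsto (fun t => (E ⊤ η t).toReal) (𝓝[<] t)
      (𝓝 (sSup ((fun t => (E ⊤ η t).toReal) '' Ioo 0 t))) ∧
    BddAbove ((fun t => (E ⊤ η t).toReal) '' Ioo 0 t) := by
  have hm := monotoneOn_toReal_E_top hη hη0
  have hsub : Ioo 0 t ⊆ timeDomain (SInfty η) := fun s hs => mem_timeDomain_of_le ht hs.1.le hs.2.le
  have hb : BddAbove ((fun t => (E ⊤ η t).toReal) '' Ioo 0 t) :=
    ⟨(E ⊤ η t).toReal, by rintro _ ⟨s, hs, rfl⟩; exact hm (hsub hs) ht hs.2.le⟩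
  exact ⟨(hm.mono hsub).tendsto_nhdsWithin_Ioo_left (nonempty_Ioo.2 h0) hb, hb⟩

lemma isCadlag_toReal_E_top (hη : ContinuousOn η (Ici 0)) (hη0 : η 0 = 0) :
    IsCadlag (SInfty η) (fun t => (E ⊤ η t).toReal) := by
  refine ⟨fun t ht => ?_, fun t ht h0 => ⟨_, (tendsto_toReal_E_top_nhdsLT hη hη0 ht h0).1⟩⟩
  have hdom := timeDomain_mem_nhdsGE ht
  refine tendsto_order.2 ⟨fun a ha => ?_, fun a ha => ?_⟩
  · filter_upwards [hdom, self_mem_nhdsWithin] with s hs hts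
    exact ha.trans_le (monotoneOn_toReal_E_top hη hη0 ht hs hts)
  · have ha0 : 0 ≤ a := (toReal_E_nonneg _ _ _).trans ha.le
    have := (toReal_E_top_lt_iff hη hη0 ht ha0).1 ha
    -- Right continuity: exiting before `a` amounts to `s < S η a`, an open condition on `s`.
    filter_upwards [hdom, mem_nhdsWithin_of_mem_nhds (gt_mem_nhds this)] with s hs hsa
    exact (toReal_E_top_lt_iff hη hη0 hs ha0).2 hsa

/-- The left limit is the left-continuous inverse of the supremum. Paired with
`le_toReal_E_top_iff`, it shows that a level `z` lies on the segment over `s` exactly when `S η z =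
s`. -/
lemma leftValue_toReal_E_top_le_iff (hη : ContinuousOn η (Ici 0)) (hη0 : η 0 = 0)
    (ht : t ∈ timeDomain (SInfty η)) {z : ℝ} (hz : 0 ≤ z) :
    leftValue (fun t => (E ⊤ η t).toReal) t ≤ z ↔ t ≤ S η z := by
  rcases ht.1.eq_or_lt with rfl | h0
  · simpa [leftValue, hz] using S_nonneg hη hη0 hz
  obtain ⟨hlim, hb⟩ := tendsto_toReal_E_top_nhdsLT hη hη0 ht h0
  rw [leftValue, if_neg h0.not_ge, leftLim_eq_of_tendsto hlim,
    csSup_le_iff hb ((nonempty_Ioo.2 h0).image _)]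
  have hsub : Ioo 0 t ⊆ timeDomain (SInfty η) := fun s hs => mem_timeDomain_of_le ht hs.1.le hs.2.le
  constructor
  · intro h
    refine le_of_forall_lt_imp_le_of_dense fun s hst => ?_
    rcases le_or_gt s 0 with hs0 | hs0
    · exact hs0.trans (S_nonneg hη hη0 hz)
    · rw [← S_toReal_E_top hη hη0 (hsub ⟨hs0, hst⟩)]
      exact S_mono hη hη0 (toReal_E_nonneg _ _ _) (h _ ⟨s, ⟨hs0, hst⟩, rfl⟩)
  · rintro h _ ⟨s, hs, rfl⟩
    exact ((toReal_E_top_lt_iff hη hη0 (hsub hs) hz).2 (hs.2.trans_le h)).le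

lemma completedGraph_toReal_E_top (hη : ContinuousOn η (Ici 0)) (hη0 : η 0 = 0)
    (ht : t ∈ timeDomain (SInfty η)) :
    completedGraph t (fun t => (E ⊤ η t).toReal) =
      (fun z => (z, S η z)) '' Icc 0 (E ⊤ η t).toReal := by
  have hdom : ∀ s ∈ Icc 0 t, s ∈ timeDomain (SInfty η) := fun s hs =>
    mem_timeDomain_of_le ht hs.1 hs.2
  have hleft : ∀ s ∈ Icc 0 t, leftValue (fun t => (E ⊤ η t).toReal) s ≤ (E ⊤ η s).toReal :=
    fun s hs => (leftValue_toReal_E_top_le_iff hη hη0 (hdom s hs) (toReal_E_nonneg _ _ _)).2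
      (S_toReal_E_top hη hη0 (hdom s hs)).ge
  have hleft0 : ∀ s ∈ Icc 0 t, 0 ≤ leftValue (fun t => (E ⊤ η t).toReal) s := fun s hs => by
    rcases hs.1.eq_or_lt with rfl | h0
    · simp [leftValue]
    · rw [leftValue, if_neg h0.not_ge]
      refine ge_of_tendsto' (f := fun t => (E ⊤ η t).toReal) (x := 𝓝[<] s) ?_
        fun _ => toReal_E_nonneg _ _ _
      have := (tendsto_toReal_E_top_nhdsLT hη hη0 (hdom s hs) h0).1
      rwa [← leftLim_eq_of_tendsto this] at this
  ext ⟨z, s⟩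
  constructor
  · rintro ⟨hs : s ∈ Icc 0 t, hz : z ∈ uIcc _ _⟩
    rw [uIcc_of_le (hleft s hs)] at hz
    have hz0 := (hleft0 s hs).trans hz.1
    have h1 := (leftValue_toReal_E_top_le_iff hη hη0 (hdom s hs) hz0).1 hz.1
    have h2 := (le_toReal_E_top_iff hη hη0 (hdom s hs) hz0).1 hz.2
    exact ⟨z, ⟨hz0, hz.2.trans (monotoneOn_toReal_E_top hη hη0 (hdom s hs) ht hs.2)⟩,
      by simp only [le_antisymm h2 h1]⟩
  · rintro ⟨z, hz, hzs⟩
    obtain ⟨rfl, rfl⟩ := Prod.mk.inj hzs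
    have hs : S η z ∈ Icc 0 t :=
      ⟨S_nonneg hη hη0 hz.1, (le_toReal_E_top_iff hη hη0 ht hz.1).1 hz.2⟩
    refine ⟨hs, ?_⟩
    simp only
    rw [uIcc_of_le (hleft _ hs)]
    exact ⟨(leftValue_toReal_E_top_le_iff hη hη0 (hdom _ hs) hz.1).2 le_rfl,
      (le_toReal_E_top_iff hη hη0 (hdom _ hs) hz.1).2 le_rfl⟩

end ExitTime

/-! ### Parametric representations by the space coordinate. -/

/-- Running through the levels at constant speed respects the graph order: `hleft` puts each level
above the left limit, so the distance to that limit grows with the level while time stands still. -/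
lemma isParamRep_of_completedGraph_eq {x H : ℝ → ℝ} {t a : ℝ} (ha : 0 ≤ a)
    (hH : ContinuousOn H (Icc 0 a)) (hmono : MonotoneOn H (Icc 0 a))
    (hgraph : completedGraph t x = (fun z => (z, H z)) '' Icc 0 a)
    (hleft : ∀ z ∈ Icc 0 a, leftValue x (H z) ≤ z) :
    IsParamRep t x (fun v => (v * a, H (v * a))) := by
  have hmaps : MapsTo (fun v => v * a) (Icc 0 1) (Icc 0 a) := fun v hv =>
    ⟨mul_nonneg hv.1 ha, mul_le_of_le_one_left ha hv.2⟩
  refine ⟨?_, ?_, fun v hv w hw hvw => ?_⟩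
  · have h1 : ContinuousOn (fun v => v * a) (Icc 0 1) := by fun_prop
    exact h1.prodMk (hH.comp h1 hmaps)
  · rw [hgraph, show (fun v => (v * a, H (v * a))) = (fun z => (z, H z)) ∘ fun v => v * a from rfl,
      image_comp]
    congr 1
    refine hmaps.image_subset.antisymm fun z hz => ?_
    rcases ha.eq_or_lt with rfl | ha0
    · exact ⟨0, by simp, by simpa using (le_antisymm hz.2 hz.1).symm⟩
    · exact ⟨z / a, ⟨div_nonneg hz.1 ha, div_le_one_of_le₀ hz.2 ha⟩, div_mul_cancel₀ z ha0.ne'⟩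
  · have hle : v * a ≤ w * a := by gcongr
    rcases (hmono (hmaps hv) (hmaps hw) hle).lt_or_eq with h | h
    · exact Or.inl h
    · refine Or.inr ⟨h, ?_⟩
      have h1 := hleft _ (hmaps hv)
      simp only [abs_sub_comm (leftValue x (H (v * a)))]
      rw [abs_of_nonneg (sub_nonneg.2 h1), abs_of_nonneg (sub_nonneg.2 (h1.trans hle))]
      gcongr

lemma isParamRep_toReal_E_top {η : ℝ → ℝ} {t : ℝ} (hη : ContinuousOn η (Ici 0)) (hη0 : η 0 = 0)
    (ht : t ∈ timeDomain (SInfty η)) :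
    IsParamRep t (fun t => (E ⊤ η t).toReal)
      (fun v => (v * (E ⊤ η t).toReal, S η (v * (E ⊤ η t).toReal))) := by
  refine isParamRep_of_completedGraph_eq (toReal_E_nonneg _ _ _)
    ((continuousOn_S hη hη0).mono Icc_subset_Ici_self)
    (fun y hy z _ hyz => S_mono hη hη0 hy.1 hyz) (completedGraph_toReal_E_top hη hη0 ht)
    fun z hz => ?_
  refine (leftValue_toReal_E_top_le_iff hη hη0 ?_ hz.1).2 le_rfl
  exact mem_timeDomain_of_le ht (S_nonneg hη hη0 hz.1) ((le_toReal_E_top_iff hη hη0 ht hz.1).1 hz.2)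

lemma IsSolution.leftValue_eq {ω : ℝ → ℝ} {ε : ℝ} {T : EReal} {φ : ℝ → ℝ}
    (h : IsSolution ω ε T φ) {t : ℝ} (ht : t ∈ timeDomain T) : leftValue φ t = φ t := by
  rcases ht.1.eq_or_lt with rfl | h0
  · simp [leftValue, h.init]
  · rw [leftValue, if_neg h0.not_ge]
    exact (h.hasDerivAt ht h0).continuousAt.continuousWithinAt.leftLim_eq

lemma IsMaximalSolution.isParamRep {ω : ℝ → ℝ} {ε : ℝ} {T : EReal} {φ : ℝ → ℝ}
    (h : IsMaximalSolution ω ε T φ) (hε : 0 < ε) (hω : ContinuousOn ω (Ici 0)) (hω0 : ω 0 = 0)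
    {t : ℝ} (ht : t ∈ timeDomain T) :
    IsParamRep t φ (fun v => (v * φ t, (E T φ (v * φ t)).toReal)) := by
  have hs := h.isSolution
  refine isParamRep_of_completedGraph_eq (H := fun x => (E T φ x).toReal) (hs.nonneg t ht)
    ((h.continuousOn_toReal_E hε hω hω0).mono Icc_subset_Ici_self)
    ((h.monotoneOn_toReal_E hε hω hω0).mono Icc_subset_Ici_self) ?_ fun z hz => ?_
  · ext ⟨z, s⟩
    constructor
    · rintro ⟨hst : s ∈ Icc 0 t, hz : z ∈ uIcc _ _⟩
      have hsT := mem_timeDomain_of_le ht hst.1 hst.2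
      simp only [hs.leftValue_eq hsT, uIcc_self, mem_singleton_iff] at hz
      subst hz
      exact ⟨φ s, ⟨hs.nonneg s hsT, hs.monotoneOn hε hsT ht hst.2⟩,
        by simp only [h.toReal_E_apply hε hsT]⟩
    · rintro ⟨z, hz, hzs⟩
      obtain ⟨rfl, rfl⟩ := Prod.mk.inj hzs
      have hmem := h.toReal_E_mem hε hω hω0 hz.1
      refine ⟨⟨hmem.1, ?_⟩, ?_⟩
      · exact le_of_not_gt fun hlt => ((h.lt_toReal_E_iff hε hω hω0 hz.1 ht).1 hlt).not_ge hz.2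
      · simp only [hs.leftValue_eq hmem, h.apply_toReal_E hε hω hω0 hz.1, uIcc_self,
          mem_singleton_iff]
  · simp only [hs.leftValue_eq (h.toReal_E_mem hε hω hω0 hz.1), h.apply_toReal_E hε hω hω0 hz.1,
      le_refl]

/-! ### The limit as ε tends to 0. -/

section Limit

variable {ω : ℝ → ℝ} {T : ℝ → EReal} {φ : ℝ → ℝ → ℝ}

lemma tendstoLocallyUniformlyOn_toReal_E (hω : ContinuousOn ω (Ici 0)) (hω0 : ω 0 = 0)
    (h : ∀ ε : ℝ, 0 < ε → IsMaximalSolution ω ε (T ε) (φ ε)) :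
    TendstoLocallyUniformlyOn (fun (ε : ℝ) (x : ℝ) => (E (T ε) (φ ε) x).toReal)
      (S (fun u => u - ω u)) (𝓝[>] 0) (Ici 0) := by
  rw [Metric.tendstoLocallyUniformlyOn_iff]
  intro δ hδ x hx
  refine ⟨Ici 0 ∩ Iic (x + 1), inter_mem_nhdsWithin _ (Iic_mem_nhds (by linarith)), ?_⟩
  filter_upwards [self_mem_nhdsWithin, (tendsto_error_bound (x + 1)).eventually (gt_mem_nhds hδ)]
    with ε hε hεδ y hy
  rw [dist_comm, Real.dist_eq]
  exact ((h ε hε).abs_toReal_E_sub_S_le hε hω hω0 hy.1 hy.2).trans_lt hεδ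

lemma tendsto_toReal_E (hω : ContinuousOn ω (Ici 0)) (hω0 : ω 0 = 0)
    (h : ∀ ε : ℝ, 0 < ε → IsMaximalSolution ω ε (T ε) (φ ε)) {x : ℝ} (hx : 0 ≤ x) :
    Tendsto (fun ε => (E (T ε) (φ ε) x).toReal) (𝓝[>] 0) (𝓝 (S (fun u => u - ω u) x)) :=
  (tendstoLocallyUniformlyOn_toReal_E hω hω0 h).tendsto_at hx

/-- Some level has supremum beyond `t`. Its exit times converge to that supremum, so they eventually
exceed `t`, and they lie in the time domain. -/
lemma eventually_mem_timeDomain (hω : ContinuousOn ω (Ici 0)) (hω0 : ω 0 = 0)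
    (h : ∀ ε : ℝ, 0 < ε → IsMaximalSolution ω ε (T ε) (φ ε)) {t : ℝ}
    (ht : t ∈ timeDomain (SInfty fun u => u - ω u)) :
    ∀ᶠ ε in 𝓝[>] (0 : ℝ), t ∈ timeDomain (T ε) := by
  have hη : ContinuousOn (fun u => u - ω u) (Ici 0) := continuousOn_id.sub hω
  have hη0 : (0 : ℝ) - ω 0 = 0 := by simp [hω0]
  obtain ⟨u, hu0, hu⟩ := exists_lt_of_mem_timeDomain_SInfty hη0 ht
  have hS := hu.trans_le (le_S_of_mem_Icc hη hη0 (right_mem_Icc.2 hu0.le))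
  filter_upwards [self_mem_nhdsWithin,
    (tendsto_toReal_E hω hω0 h hu0.le).eventually (lt_mem_nhds hS)] with ε hε hlt
  exact mem_timeDomain_of_le ((h ε hε).toReal_E_mem hε hω hω0 hu0.le) ht.1 hlt.le

/-- Pointwise convergence at the continuity points of the limit. -/
lemma tendsto_apply (hω : ContinuousOn ω (Ici 0)) (hω0 : ω 0 = 0)
    (h : ∀ ε : ℝ, 0 < ε → IsMaximalSolution ω ε (T ε) (φ ε)) {t : ℝ} (h0 : 0 < t)
    (ht : t ∈ timeDomain (SInfty fun u => u - ω u))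
    (hc : ContinuousAt (fun t => (E ⊤ (fun u => u - ω u) t).toReal) t) :
    Tendsto (fun ε => φ ε t) (𝓝[>] 0) (𝓝 (E ⊤ (fun u => u - ω u) t).toReal) := by
  have hη : ContinuousOn (fun u => u - ω u) (Ici 0) := continuousOn_id.sub hω
  have hη0 : (0 : ℝ) - ω 0 = 0 := by simp [hω0]
  -- Continuity at `t` identifies the left- and right-continuous inverses there, so each level `z`
  -- in `[0, a)`, with `a` the limit value, satisfies the strict inequality `S z < t`.
  have hleft : leftValue (fun t => (E ⊤ (fun u => u - ω u) t).toReal) t =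
      (E ⊤ (fun u => u - ω u) t).toReal := by
    rw [leftValue, if_neg h0.not_ge]
    exact hc.continuousWithinAt.leftLim_eq
  have hdom := eventually_mem_timeDomain hω hω0 h ht
  refine tendsto_order.2 ⟨fun z hz => ?_, fun z hz => ?_⟩
  · rcases lt_or_ge z 0 with hz0 | hz0
    · filter_upwards [hdom, self_mem_nhdsWithin] with ε htε hε
      exact hz0.trans_le ((h ε hε).isSolution.nonneg t htε)
    · have hS : S (fun u => u - ω u) z < t := by
        rw [← hleft] at hz
        exact not_le.1 fun hle => hz.not_ge ((leftValue_toReal_E_top_le_iff hη hη0 ht hz0).2 hle)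
      filter_upwards [hdom, self_mem_nhdsWithin,
        (tendsto_toReal_E hω hω0 h hz0).eventually (gt_mem_nhds hS)] with ε htε hε hlt
      exact ((h ε hε).toReal_E_lt_iff hε hω hω0 hz0 htε).1 hlt
  · have hz0 : 0 ≤ z := (toReal_E_nonneg _ _ _).trans hz.le
    have hS := (toReal_E_top_lt_iff hη hη0 ht hz0).1 hz
    filter_upwards [hdom, self_mem_nhdsWithin,
      (tendsto_toReal_E hω hω0 h hz0).eventually (lt_mem_nhds hS)] with ε htε hε hlt
    exact ((h ε hε).lt_toReal_E_iff hε hω hω0 hz0 htε).1 hlt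

lemma tendsto_m1Dist (hω : ContinuousOn ω (Ici 0)) (hω0 : ω 0 = 0)
    (h : ∀ ε : ℝ, 0 < ε → IsMaximalSolution ω ε (T ε) (φ ε)) {t : ℝ} (h0 : 0 < t)
    (ht : t ∈ timeDomain (SInfty fun u => u - ω u))
    (hc : ContinuousAt (fun t => (E ⊤ (fun u => u - ω u) t).toReal) t) :
    Tendsto (fun ε => m1Dist t (φ ε) (fun t => (E ⊤ (fun u => u - ω u) t).toReal))
      (𝓝[>] 0) (𝓝 0) := by
  have hη : ContinuousOn (fun u => u - ω u) (Ici 0) := continuousOn_id.sub hω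
  have hη0 : (0 : ℝ) - ω 0 = 0 := by simp [hω0]
  set a := (E ⊤ (fun u => u - ω u) t).toReal
  have ha0 : 0 ≤ a := toReal_E_nonneg _ _ _
  rw [ENNReal.tendsto_nhds_zero]
  intro r hr
  obtain ⟨δ, hδ0, hδr⟩ := ENNReal.lt_iff_exists_nnreal_btwn.1 hr
  have hδ : (0 : ℝ) < δ := by exact_mod_cast hδ0
  obtain ⟨ρ, hρ, huc⟩ := Metric.uniformContinuousOn_iff.1
    ((isCompact_Icc (a := (0 : ℝ)) (b := a + 1)).uniformContinuousOn_of_continuous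
      ((continuousOn_S hη hη0).mono Icc_subset_Ici_self)) (δ / 2) (half_pos hδ)
  -- The tolerance `δ` serves the space coordinate, `ρ` the modulus of continuity of the supremum,
  -- and 1 keeps all levels in `[0, a + 1]`. In the time coordinate, the error bound and the modulus
  -- cost `δ / 2` each.
  filter_upwards [eventually_mem_timeDomain hω hω0 h ht, self_mem_nhdsWithin,
    (Metric.tendsto_nhds.1 (tendsto_apply hω hω0 h h0 ht hc)) (min δ (min ρ 1))
      (lt_min hδ (lt_min hρ one_pos)),
    (tendsto_error_bound (a + 1)).eventually (gt_mem_nhds (half_pos hδ))] with ε htε hε hφ hb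
  rw [Real.dist_eq, lt_min_iff, lt_min_iff] at hφ
  obtain ⟨hφδ, hφρ, hφ1⟩ := hφ
  have hφ0 := (h ε hε).isSolution.nonneg t htε
  refine le_trans ?_ hδr.le
  refine (iInf₂_le_of_le _ _ <| iInf₂_le ((h ε hε).isParamRep hε hω hω0 htε)
    (isParamRep_toReal_E_top hη hη0 ht)).trans ?_
  refine iSup₂_le fun v hv => ?_
  have hva : |v * φ ε t - v * a| ≤ |φ ε t - a| := by
    rw [← mul_sub, abs_mul, abs_of_nonneg hv.1]
    exact mul_le_of_le_one_left (abs_nonneg _) hv.2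
  have hφa : φ ε t ≤ a + 1 := by linarith [(abs_lt.1 hφ1).2]
  have h1 : v * φ ε t ∈ Icc 0 (a + 1) :=
    ⟨mul_nonneg hv.1 hφ0, (mul_le_of_le_one_left hφ0 hv.2).trans hφa⟩
  have h2 : v * a ∈ Icc 0 (a + 1) :=
    ⟨mul_nonneg hv.1 ha0, (mul_le_of_le_one_left ha0 hv.2).trans (by linarith)⟩
  rw [edist_nndist, ENNReal.coe_le_coe, ← NNReal.coe_le_coe, coe_nndist, Prod.dist_eq]
  refine max_le (hva.trans hφδ.le) ?_
  have h3 := (h ε hε).abs_toReal_E_sub_S_le hε hω hω0 h1.1 h1.2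
  have h4 := huc _ h1 _ h2 (hva.trans_lt hφρ)
  refine (dist_triangle _ (S (fun u => u - ω u) (v * φ ε t)) _).trans ?_
  rw [Real.dist_eq]
  simp only
  linarith

end Limit

end CIR

end

theorem theorem2 (ω : ℝ → ℝ) (hω : ContinuousOn ω (Set.Ici 0)) (hω0 : ω 0 = 0) :
    -- every solution: its exit time is its inverse and satisfies the two bounds
    (∀ (ε : ℝ) (T : EReal) (φ : ℝ → ℝ), 0 < ε → CIR.IsMaximalSolution ω ε T φ →
      Set.BijOn φ (CIR.timeDomain T) (Set.Ici 0) ∧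
      (∀ t ∈ CIR.timeDomain T, CIR.E T φ (φ t) = (t : EReal)) ∧
      ∀ x : ℝ, 0 ≤ x →
        ((CIR.S (fun u => u - ω u) x - ε : ℝ) : EReal) ≤ CIR.E T φ x ∧
        CIR.E T φ x ≤ ((CIR.S (fun u => u - ω u) x + 2 * √(x * ε) : ℝ) : EReal)) ∧
    -- the limits as ε → 0 of a family of solutions
    (∀ (T : ℝ → EReal) (φ : ℝ → ℝ → ℝ),
      (∀ ε : ℝ, 0 < ε → CIR.IsMaximalSolution ω ε (T ε) (φ ε)) →
      -- exit times: convergence in the space of continuous paths from zero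
      ((∀ ε : ℝ, 0 < ε →
          ContinuousOn (fun x => (CIR.E (T ε) (φ ε) x).toReal) (Set.Ici 0) ∧
          CIR.E (T ε) (φ ε) 0 = 0) ∧
        ContinuousOn (CIR.S (fun u => u - ω u)) (Set.Ici 0) ∧
        CIR.S (fun u => u - ω u) 0 = 0 ∧
        TendstoLocallyUniformlyOn (fun (ε : ℝ) (x : ℝ) => (CIR.E (T ε) (φ ε) x).toReal)
          (CIR.S (fun u => u - ω u)) (𝓝[>] 0) (Set.Ici 0)) ∧
      -- solutions: convergence in the space of càdlàg paths
      ((∀ t ∈ CIR.timeDomain (CIR.SInfty (fun u => u - ω u)),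
          CIR.E ⊤ (fun u => u - ω u) t ≠ ⊤) ∧
        CIR.IsCadlag (CIR.SInfty (fun u => u - ω u))
          (fun t => (CIR.E ⊤ (fun u => u - ω u) t).toReal) ∧
        CIR.TendstoM1 (𝓝[>] (0 : ℝ)) T φ (CIR.SInfty (fun u => u - ω u))
          (fun t => (CIR.E ⊤ (fun u => u - ω u) t).toReal))) := by
  have hη : ContinuousOn (fun u => u - ω u) (Ici 0) := continuousOn_id.sub hω
  have hη0 : (0 : ℝ) - ω 0 = 0 := by simp [hω0]
  refine ⟨fun ε T φ hε h => ⟨h.bijOn hε hω hω0, fun t ht => h.isSolution.E_apply hε ht,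
    fun x hx => h.E_bounds hε hω hω0 hx⟩, fun T φ h => ⟨⟨fun ε hε => ⟨?_, ?_⟩, ?_, ?_, ?_⟩, ?_, ?_, ?_⟩⟩
  · exact (h ε hε).continuousOn_toReal_E hε hω hω0
  · have hs := (h ε hε).isSolution
    simpa [hs.init] using hs.E_apply hε hs.zero_mem
  · exact CIR.continuousOn_S hη hη0
  · exact CIR.S_zero
  · exact CIR.tendstoLocallyUniformlyOn_toReal_E hω hω0 h
  · exact fun t ht => CIR.E_top_ne_top hη0 ht
  · exact CIR.isCadlag_toReal_E_top hη hη0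
  · exact fun t h0 ht hc => ⟨(CIR.eventually_mem_timeDomain hω hω0 h ⟨h0.le, ht⟩).mono
      fun _ hε => hε.2, CIR.tendsto_m1Dist hω hω0 h h0 ⟨h0.le, ht⟩ hc⟩
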